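/- Let $n_1,n_2\ge 2$ be integers, $0<q<2$, $s>0$ and $\sigma>0$. One observes the $n_1\times n_2$ real random matrix $Y=A+E$, where the entries $\xi_{ij}$ of $E$ are i.i.d. Gaussian $\mathcal N(0,\sigma^2)$ and $A$ is an unknown matrix. Let $$\mathcal A(q,s)=\Big\{A\in\mathbb R^{n_1\times n_2}:\ \sum_{j=1}^{n_2}|a_{ij}|^q\le s\ \text{ for every } i=1,\dots,n_1\Big\},$$ let $\|A\|_2=\big(\sum_{i,j}a_{ij}^2\big)^{1/2}$, and put $$\eta(s)=\min\Big\{\,n_1 s\Big[\sigma^2\log\Big(1+\frac{\sigma^q n_2}{s}\Big)\Big]^{1-q/2},\ \ n_1 s^{2/q},\ \ n_1n_2\sigma^2\Big\}.$$ Then there exist numerical constants $c^*>0$ and $0<\beta<1$ (not depending on $n_1,n_2,q,s,\sigma$) such that $$\text{(i)}\qquad \inf_{\hat A}\ \sup_{A\in\mathcal A(q,s)}\mathbb P\big\{\|\hat A-A\|_2^2\ge c^*\eta(s)\big\}\ \ge\ \beta,$$ $$\text{(ii)}\qquad \inf_{\hat A}\ \sup_{A\in\mathcal A(q,s)}\mathbb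 E\,\|\hat A-A\|_2^2\ \ge\ c^*\eta(s),$$ where the infimum is over all estimators $\hat A$, i.e. all measurable functions of $Y$ with values in $\mathbb R^{n_1\times n_2}$. -/

import Mathlib

open MeasureTheory ProbabilityTheory
open scoped ENNReal

/-- The `l_q`-ball `B_q(s)` in `ℝ^n`, for `q > 0`: vectors `v` with `∑ j, |v j| ^ q ≤ s`. -/
def lqBall (n : ℕ) (q s : ℝ) : Set (Fin n → ℝ) :=
  {v | ∑ j, |v j| ^ q ≤ s}

/-- The class `A(q, s)` of `n₁ × n₂` real matrices all of whose rows lie in `B_q(s)`. -/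
def softSparse (n₁ n₂ : ℕ) (q s : ℝ) : Set (Matrix (Fin n₁) (Fin n₂) ℝ) :=
  {A | ∀ i, A i ∈ lqBall n₂ q s}

/-- The elementwise `l_2` (Frobenius) norm of a real matrix. -/
noncomputable def frobNorm {n₁ n₂ : ℕ} (A : Matrix (Fin n₁) (Fin n₂) ℝ) : ℝ :=
  Real.sqrt (∑ i, ∑ j, A i j ^ 2)

/-- The rate `η(s)`: the minimum of
`n₁ s [σ² log (1 + σ^q n₂ / s)]^(1 - q/2)`, `n₁ s^(2/q)` and `n₁ n₂ σ²`. -/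
noncomputable def etaRate (n₁ n₂ : ℕ) (q s σ : ℝ) : ℝ :=
  min (min ((n₁ : ℝ) * s * (σ ^ 2 * Real.log (1 + σ ^ q * (n₂ : ℝ) / s)) ^ (1 - q / 2))
      ((n₁ : ℝ) * s ^ (2 / q)))
    ((n₁ : ℝ) * (n₂ : ℝ) * σ ^ 2)

/-- The noise entries `ξ i j` are i.i.d. Gaussian `N(0, σ²)` under `P`. -/
def IsGaussianNoise {Ω : Type*} [MeasurableSpace Ω] {n₁ n₂ : ℕ} (P : Measure Ω)
    (ξ : Ω → Matrix (Fin n₁) (Fin n₂) ℝ) (σ : ℝ) : Prop :=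
  iIndepFun (fun (p : Fin n₁ × Fin n₂) ω => ξ ω p.1 p.2) P ∧
    ∀ i j, HasLaw (fun ω => ξ ω i j) (gaussianReal 0 (σ ^ 2).toNNReal) P

/-- An estimator of an `n₁ × n₂` matrix: a measurable (that is, entrywise measurable) function
of the observed matrix, with matrix values. Matrices carry the product σ-algebra. -/
def IsEstimator {n₁ n₂ : ℕ}
    (T : Matrix (Fin n₁) (Fin n₂) ℝ → Matrix (Fin n₁) (Fin n₂) ℝ) : Prop :=
  Measurable (fun (y : Fin n₁ → Fin n₂ → ℝ) i j => T (Matrix.of y) i j)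

/-! The bad matrices are spiky. Each row is cut into `k` blocks of length `m`, and every block
carries one spike of size `σ * d` at an unknown place. With `d ^ 2 ≤ log m / 2` the noise hides the
place: the likelihood ratio of one spike has second moment `exp (d ^ 2) ≤ 5 / 7 * m`, so no test
finds the spike with average success above 7/8 (`sum_pi_gaussianReal_add_single_le`). An estimator
with error below half the squared spike on a block would be such a test.

Averaging over all placements gives one placement for which the expected share of well-estimated
blocks is at most 7/8; Markov's inequality then makes the total error of order `n₁ * k * (σ * d) ^
2` with probability at least 1/16 (`exists_spikes_lower_bound`). Finally `exists_spike_parameters`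
fits `k`, `m`, `d` into the `l_q` budget of a row so that this total matches the rate. -/

/-! ### Gaussian shifts and testing between them. -/

/-- The density of `N(a, v)` with respect to `N(0, v)`. -/
noncomputable def gaussianShiftDensity (v : NNReal) (a x : ℝ) : ℝ :=
  Real.exp (a * x / v - a ^ 2 / (2 * v))

@[fun_prop]
lemma measurable_gaussianShiftDensity (v : NNReal) (a : ℝ) :
    Measurable (gaussianShiftDensity v a) := by
  unfold gaussianShiftDensity; fun_prop

lemma gaussianReal_eq_withDensity_shift {v : NNReal} (hv : v ≠ 0) (a : ℝ) :
    gaussianReal a v =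
      (gaussianReal 0 v).withDensity fun x => ENNReal.ofReal (gaussianShiftDensity v a x) := by
  rw [gaussianReal_of_var_ne_zero _ hv, gaussianReal_of_var_ne_zero _ hv,
    ← withDensity_mul _ (measurable_gaussianPDF 0 v) (by fun_prop)]
  congr 1
  ext x
  have hv' : (v : ℝ) ≠ 0 := by exact_mod_cast hv
  rw [Pi.mul_apply, gaussianPDF_def, gaussianPDF_def,
    ← ENNReal.ofReal_mul (gaussianPDFReal_nonneg _ _ _), gaussianPDFReal_def, gaussianPDFReal_def,
    gaussianShiftDensity]
  beta_reduce
  rw [mul_assoc _ (Real.exp _), ← Real.exp_add]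
  congr 3
  field_simp
  ring

lemma lintegral_pi_prod {ι : Type*} [Fintype ι] {X : ι → Type*} [∀ i, MeasurableSpace (X i)]
    (μ : ∀ i, Measure (X i)) [∀ i, IsProbabilityMeasure (μ i)] (f : ∀ i, X i → ℝ≥0∞)
    (hf : ∀ i, Measurable (f i)) :
    ∫⁻ x, ∏ i, f i (x i) ∂Measure.pi μ = ∏ i, ∫⁻ x, f i x ∂μ i := by
  have hind : iIndepFun (fun i (x : ∀ i, X i) => f i (x i)) (Measure.pi μ) :=
    iIndepFun_pi fun i => (hf i).aemeasurable
  rw [lintegral_prod_eq_prod_lintegral_of_indepFun Finset.univ _ hind (by fun_prop)]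
  refine Finset.prod_congr rfl fun i _ => ?_
  exact (measurePreserving_eval μ i).lintegral_comp (hf i)

/-- Cameron-Martin formula for a finite product of centred Gaussian measures. -/
lemma pi_gaussianReal_map_add {ι : Type*} [Fintype ι] {v : NNReal} (hv : v ≠ 0) (θ : ι → ℝ) :
    (Measure.pi fun _ : ι => gaussianReal 0 v).map (fun y => y + θ) =
      (Measure.pi fun _ : ι => gaussianReal 0 v).withDensity
        fun y => ∏ i, ENNReal.ofReal (gaussianShiftDensity v (θ i) (y i)) := by
  have h1 : (Measure.pi fun _ : ι => gaussianReal 0 v).map (fun y => y + θ) =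
      Measure.pi fun i => gaussianReal (θ i) v := by
    have := Measure.pi_map_pi (μ := fun _ : ι => gaussianReal 0 v)
      (f := fun i x => x + θ i) (fun i => by fun_prop)
    simp only [gaussianReal_map_add_const, zero_add] at this
    exact this
  rw [h1]
  refine Measure.pi_eq fun s hs => ?_
  rw [withDensity_apply _ (MeasurableSet.univ_pi hs),
    ← lintegral_indicator (MeasurableSet.univ_pi hs)]
  have h2 : ∀ y : ι → ℝ, (Set.univ.pi s).indicator
      (fun y => ∏ i, ENNReal.ofReal (gaussianShiftDensity v (θ i) (y i))) y =
      ∏ i, (s i).indicator (fun x => ENNReal.ofReal (gaussianShiftDensity v (θ i) x)) (y i) := by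
    intro y
    by_cases hy : ∀ i, y i ∈ s i
    · rw [Set.indicator_of_mem (by simpa using hy)]
      exact Finset.prod_congr rfl fun i _ => by rw [Set.indicator_of_mem (hy i)]
    · rw [Set.indicator_of_notMem (by simpa using hy)]
      push Not at hy
      obtain ⟨i, hi⟩ := hy
      exact (Finset.prod_eq_zero (Finset.mem_univ i) (Set.indicator_of_notMem hi _)).symm
  simp_rw [h2]
  rw [lintegral_pi_prod _ _ fun i => Measurable.indicator (by fun_prop) (hs i)]
  refine Finset.prod_congr rfl fun i _ => ?_
  rw [lintegral_indicator (hs i), gaussianReal_eq_withDensity_shift hv (θ i),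
    withDensity_apply _ (hs i)]

lemma pi_gaussianReal_add_single {ι : Type*} [Fintype ι] [DecidableEq ι] {v : NNReal}
    (hv : v ≠ 0) (p : ι) (δ : ℝ) {S : Set (ι → ℝ)} (hS : MeasurableSet S) :
    (Measure.pi fun _ : ι => gaussianReal 0 v) {y | y + Pi.single p δ ∈ S} =
      ∫⁻ y in S, ENNReal.ofReal (gaussianShiftDensity v δ (y p))
        ∂(Measure.pi fun _ : ι => gaussianReal 0 v) := by
  have h := congrArg (fun μ => μ S) (pi_gaussianReal_map_add hv (Pi.single p δ))
  simp only at h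
  rw [Measure.map_apply (by fun_prop) hS, withDensity_apply _ hS] at h
  refine h.trans (lintegral_congr fun y => ?_)
  rw [Finset.prod_eq_single p]
  · simp
  · intro i _ hi
    simp [Pi.single_eq_of_ne hi, gaussianShiftDensity]
  · simp

/-- The squared likelihood ratio is again a likelihood ratio, for the doubled shift, so its mean is
just the prefactor. -/
lemma gaussianShiftDensity_sq {v : NNReal} (hv : v ≠ 0) (a x : ℝ) :
    gaussianShiftDensity v a x ^ 2 =
      Real.exp (a ^ 2 / v) * gaussianShiftDensity v (2 * a) x := by
  have hv' : (v : ℝ) ≠ 0 := by exact_mod_cast hv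
  rw [gaussianShiftDensity, gaussianShiftDensity, ← Real.exp_add, ← Real.exp_nat_mul]
  congr 1
  field_simp
  push_cast
  ring

lemma lintegral_gaussianShiftDensity_sq {ι : Type*} [Fintype ι] {v : NNReal}
    (hv : v ≠ 0) (p : ι) (δ : ℝ) :
    ∫⁻ y, ENNReal.ofReal (gaussianShiftDensity v δ (y p) ^ 2)
        ∂(Measure.pi fun _ : ι => gaussianReal 0 v) = ENNReal.ofReal (Real.exp (δ ^ 2 / v)) := by
  classical
  have h := pi_gaussianReal_add_single hv p (2 * δ) MeasurableSet.univ
  simp only [Set.mem_univ, Set.ofPred_true, measure_univ, Measure.restrict_univ] at h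
  simp_rw [gaussianShiftDensity_sq hv, ENNReal.ofReal_mul (Real.exp_nonneg _)]
  rw [lintegral_const_mul _ (by fun_prop), ← h, mul_one]

/-- Testing between `m` single-coordinate Gaussian shifts of size `δ`: if `δ` is small compared
with `√(log m)`, disjoint acceptance regions cannot all be accurate. -/
lemma sum_pi_gaussianReal_add_single_le {ι : Type*} [Fintype ι] [DecidableEq ι] {v : NNReal}
    (hv : v ≠ 0) {m : ℕ} (hm : 0 < m) (p : Fin m → ι) (δ : ℝ)
    (hδ : Real.exp (δ ^ 2 / v) ≤ 5 / 7 * m) (S : Fin m → Set (ι → ℝ))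
    (hS : ∀ j, MeasurableSet (S j)) (hd : Pairwise (Function.onFun Disjoint S)) :
    ∑ j, (Measure.pi fun _ : ι => gaussianReal 0 v) {y | y + Pi.single (p j) δ ∈ S j} ≤
      ENNReal.ofReal (7 / 8 * m) := by
  set μ := Measure.pi fun _ : ι => gaussianReal 0 v
  have hm' : (0 : ℝ) < m := by exact_mod_cast hm
  have key : ∀ j, μ {y | y + Pi.single (p j) δ ∈ S j} ≤
      ENNReal.ofReal (5 / 14) + ENNReal.ofReal (m / 2) * μ (S j) := by
    intro j
    rw [pi_gaussianReal_add_single hv (p j) δ (hS j)]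
    calc ∫⁻ y in S j, ENNReal.ofReal (gaussianShiftDensity v δ (y (p j))) ∂μ
        -- AM-GM: `L ≤ L ^ 2 / (2 * m) + m / 2`. The first term costs at most 5/14 per hypothesis;
        -- the second sums to `m / 2` by disjointness. The total is `6 / 7 * m`.
        ≤ ∫⁻ y in S j, (ENNReal.ofReal (1 / (2 * m)) *
            ENNReal.ofReal (gaussianShiftDensity v δ (y (p j)) ^ 2) + ENNReal.ofReal (m / 2)) ∂μ := by
          refine lintegral_mono fun y => ?_
          rw [← ENNReal.ofReal_mul (by positivity), ← ENNReal.ofReal_add (by positivity)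
            (by positivity)]
          refine ENNReal.ofReal_le_ofReal ?_
          set L := gaussianShiftDensity v δ (y (p j))
          have : 1 / (2 * (m : ℝ)) * L ^ 2 + m / 2 - L = (L - m) ^ 2 / (2 * m) := by
            field_simp; ring
          have h2 : 0 ≤ (L - m) ^ 2 / (2 * (m : ℝ)) := by positivity
          linarith
      _ = ENNReal.ofReal (1 / (2 * m)) * ∫⁻ y in S j,
            ENNReal.ofReal (gaussianShiftDensity v δ (y (p j)) ^ 2) ∂μ +
            ENNReal.ofReal (m / 2) * μ (S j) := by
          rw [lintegral_add_right _ measurable_const, lintegral_const_mul _ (by fun_prop),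
            setLIntegral_const]
      _ ≤ ENNReal.ofReal (5 / 14) + ENNReal.ofReal (m / 2) * μ (S j) := by
          gcongr
          calc _ ≤ ENNReal.ofReal (1 / (2 * m)) * ∫⁻ y,
              ENNReal.ofReal (gaussianShiftDensity v δ (y (p j)) ^ 2) ∂μ := by
                gcongr; exact Measure.restrict_le_self
            _ ≤ _ := by
              rw [lintegral_gaussianShiftDensity_sq hv, ← ENNReal.ofReal_mul (by positivity)]
              refine ENNReal.ofReal_le_ofReal ?_
              calc _ ≤ 1 / (2 * (m : ℝ)) * (5 / 7 * m) := by gcongr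
                _ = 5 / 14 := by field_simp; norm_num
  have hsum : ∑ j, μ (S j) ≤ 1 := by
    rw [← tsum_fintype (L := .unconditional _), ← measure_iUnion hd hS]
    exact prob_le_one
  calc _ ≤ ∑ j, (ENNReal.ofReal (5 / 14) + ENNReal.ofReal (m / 2) * μ (S j)) :=
        Finset.sum_le_sum fun j _ => key j
    _ = m * ENNReal.ofReal (5 / 14) + ENNReal.ofReal (m / 2) * ∑ j, μ (S j) := by
        rw [Finset.sum_add_distrib, ← Finset.mul_sum]; simp
    _ ≤ m * ENNReal.ofReal (5 / 14) + ENNReal.ofReal (m / 2) * 1 := by gcongr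
    _ ≤ _ := by
        rw [mul_one, ← ENNReal.ofReal_natCast, ← ENNReal.ofReal_mul (by positivity),
          ← ENNReal.ofReal_add (by positivity) (by positivity)]
        exact ENNReal.ofReal_le_ofReal (by linarith)

/-! ### Spike parameters in each regime of the rate. -/

/-- Choice of the number `k` of blocks per row, of the block length `m` and of the spike size `d`,
for unit noise level. -/
lemma exists_spike_parameters (n : ℕ) (hn : 2 ≤ n) (q t : ℝ) (hq : 0 < q)
    (ht : 0 < t) :
    ∃ (k m : ℕ) (d : ℝ), 0 < k ∧ 2 ≤ m ∧ k * m ≤ n ∧ 0 < d ∧ d ^ 2 ≤ Real.log m / 2 ∧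
      k * d ^ q ≤ t ∧
      min (min (t * Real.log (1 + n / t) ^ (1 - q / 2)) (t ^ (2 / q))) n ≤ 12 * (k * d ^ 2) := by
  have hn' : (2 : ℝ) ≤ n := by exact_mod_cast hn
  have hlog2 := Real.log_two_gt_d9
  have hrq : ∀ x : ℝ, 0 < x → (x ^ (1 / q)) ^ q = x := fun x hx => by
    rw [← Real.rpow_mul hx.le, one_div_mul_cancel hq.ne', Real.rpow_one]
  have hr2 : ∀ x : ℝ, 0 < x → (x ^ (1 / q)) ^ 2 = x ^ (2 / q) := fun x hx => by
    rw [← Real.rpow_natCast, ← Real.rpow_mul hx.le]; congr 1; push_cast; ring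
  -- Dense regime: blocks of length 2 with constant spikes, where `n ≤ 3 * (n / 2)` and `d ^ 2 = 1 /
  -- 4` produce the constant 12.
  rcases le_or_gt ((n : ℝ) / 2) t with hA | hB
  · refine ⟨n / 2, 2, 1 / 2, by omega, le_rfl, by omega, by norm_num, by norm_num; linarith, ?_,
      (min_le_right _ _).trans ?_⟩
    · have h1 : ((n / 2 : ℕ) : ℝ) ≤ n / 2 := Nat.cast_div_le
      have h2 : (1 / 2 : ℝ) ^ q ≤ 1 := Real.rpow_le_one (by norm_num) (by norm_num) hq.le
      calc _ ≤ (n / 2 : ℝ) * 1 := by gcongr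
        _ ≤ t := by linarith
    · have h1 : n ≤ 3 * (n / 2) := by omega
      have h2 : (n : ℝ) ≤ 3 * ((n / 2 : ℕ) : ℝ) := by exact_mod_cast h1
      linarith
  -- Very sparse regime: a single spike that uses a fixed fraction of the budget; the half keeps `d
  -- ^ 2 ≤ 1 / 4 ≤ log 2 / 2`.
  rcases lt_or_ge t 1 with ht1 | ht1
  · refine ⟨1, n, t ^ (1 / q) / 2, one_pos, hn, by omega, by positivity, ?_, ?_,
      ((min_le_left _ _).trans (min_le_right _ _)).trans ?_⟩
    · have h1 : t ^ (2 / q) ≤ 1 := Real.rpow_le_one ht.le ht1.le (by positivity)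
      have h2 : Real.log 2 ≤ Real.log n := Real.log_le_log (by norm_num) hn'
      rw [div_pow, hr2 t ht]; linarith
    · calc _ ≤ 1 * (t ^ (1 / q)) ^ q := by
            push_cast
            gcongr
            linarith [Real.rpow_pos_of_pos ht (1 / q)]
        _ = t := by rw [hrq t ht, one_mul]
    · rw [div_pow, hr2 t ht]
      have := Real.rpow_pos_of_pos ht (2 / q)
      push_cast; linarith
  set x : ℝ := n / t with hx
  have hx2 : 2 < x := by rw [hx, lt_div_iff₀ ht]; linarith
  set l := Real.log (1 + x) with hl
  have hl1 : 1 ≤ l := by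
    rw [hl, Real.le_log_iff_exp_le (by linarith)]
    linarith [Real.exp_one_lt_d9]
  -- Here `1 + x < a + 2 ≤ a ^ 2`, so the logarithm in the rate is at most `2 * log a`.
  have hfl : ∀ a : ℕ, 2 ≤ a → x < a + 1 → l / 4 ≤ Real.log a / 2 := by
    intro a ha hxa
    have ha' : (2 : ℝ) ≤ a := by exact_mod_cast ha
    have : l ≤ Real.log ((a : ℝ) ^ 2) := Real.log_le_log (by linarith) (by nlinarith)
    rw [Real.log_pow] at this
    push_cast at this
    linarith
  set D := Real.sqrt (l / 4) with hD
  have hD0 : 0 < D := Real.sqrt_pos.mpr (by linarith)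
  have hD2 : D ^ 2 = l / 4 := Real.sq_sqrt (by linarith)
  -- If the budget cannot pay for one spike of the undetectable size `D`, a single spike spends all
  -- of it.
  rcases lt_or_ge t (D ^ q) with htD | htD
  · have hle : t ^ (1 / q) ≤ D := by
      calc _ ≤ (D ^ q) ^ (1 / q) := by gcongr
        _ = D := by rw [← Real.rpow_mul hD0.le, mul_one_div_cancel hq.ne', Real.rpow_one]
    refine ⟨1, n, t ^ (1 / q), one_pos, hn, by omega, by positivity, ?_, ?_,
      ((min_le_left _ _).trans (min_le_right _ _)).trans ?_⟩
    · calc _ ≤ D ^ 2 := by gcongr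
        _ = l / 4 := hD2
        _ ≤ _ := hfl n hn (by rw [hx, div_lt_iff₀ ht]; nlinarith)
    · rw [hrq t ht]; simp
    · rw [hr2 t ht]
      have := Real.rpow_pos_of_pos ht (2 / q)
      push_cast; linarith
  -- Dividing by `M ^ q` rather than `D ^ q` forces `k ≤ t`, hence blocks of length about `n / t` or
  -- more. Since `l ≥ 1`, this loses only a constant when `D < 1`.
  set M := max D 1 with hM
  have hM1 : 1 ≤ M := le_max_right _ _
  have hMq1 : 1 ≤ M ^ q := Real.one_le_rpow hM1 hq.le
  have hMt : M ^ q ≤ t := by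
    rcases max_choice D 1 with h | h <;> rw [hM, h]
    · exact htD
    · simpa using ht1
  have hu1 : 1 ≤ t / M ^ q := by rwa [one_le_div (by positivity)]
  set k := ⌊t / M ^ q⌋₊ with hk
  have hk1 : 1 ≤ k := Nat.le_floor (by simpa using hu1)
  have hk1' : (1 : ℝ) ≤ k := by exact_mod_cast hk1
  have hku : (k : ℝ) ≤ t / M ^ q := Nat.floor_le (by positivity)
  have hkl : t / M ^ q < k + 1 := Nat.lt_floor_add_one _
  have hkt : (k : ℝ) ≤ t := hku.trans (div_le_self ht.le hMq1)
  have hxk : x ≤ n / k := by rw [hx]; gcongr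
  have hm2 : 2 ≤ n / k := by
    rw [Nat.le_div_iff_mul_le hk1]
    have : (2 * k : ℝ) ≤ n := by linarith
    exact_mod_cast this
  refine ⟨k, n / k, D, hk1, hm2, Nat.mul_div_le n k, hD0, ?_, ?_,
    ((min_le_left _ _).trans (min_le_left _ _)).trans ?_⟩
  · rw [hD2]
    refine hfl _ hm2 (hxk.trans_lt ?_)
    rw [← Nat.floor_div_eq_div (K := ℝ)]
    exact Nat.lt_floor_add_one _
  · calc _ ≤ t / M ^ q * M ^ q := by gcongr; exact le_max_left _ _
      _ = t := div_mul_cancel₀ _ (by positivity)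
  · have hkt2 : t / M ^ q ≤ 2 * k := by linarith
    have hlq : l ^ (1 - q / 2) ≤ 4 * (D ^ 2 / M ^ q) := by
      rcases le_total D 1 with h | h
      · rw [hM, max_eq_right h, Real.one_rpow, div_one, hD2]
        calc _ ≤ l ^ (1 : ℝ) := Real.rpow_le_rpow_of_exponent_le hl1 (by linarith)
          _ = 4 * (l / 4) := by rw [Real.rpow_one]; ring
      · rw [hM, max_eq_left h]
        have e1 : D ^ 2 / D ^ q = (l / 4) ^ (1 - q / 2) := by
          rw [← hD2, ← Real.rpow_natCast, ← Real.rpow_sub hD0, ← Real.rpow_mul hD0.le]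
          congr 1; push_cast; ring
        rw [e1, Real.div_rpow (by linarith) (by norm_num)]
        have e2 : (4 : ℝ) ^ (1 - q / 2) ≤ 4 := by
          calc _ ≤ (4 : ℝ) ^ (1 : ℝ) :=
                Real.rpow_le_rpow_of_exponent_le (by norm_num) (by linarith)
            _ = 4 := Real.rpow_one _
        have e3 : 0 < l ^ (1 - q / 2) := by positivity
        rw [← mul_div_assoc, le_div_iff₀ (by positivity)]
        nlinarith
    calc _ ≤ t * (4 * (D ^ 2 / M ^ q)) := by gcongr
      _ = 4 * (t / M ^ q) * D ^ 2 := by ring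
      _ ≤ 4 * (2 * k) * D ^ 2 := by gcongr
      _ ≤ 12 * (k * D ^ 2) := by nlinarith [sq_nonneg D]

/-! ### One spike per block: from testing to estimation. -/

/-- The vector with an entry `δ` at the position `pos b (J b)` for every block `b`. -/
noncomputable def spikes {ι B : Type*} [Fintype B] [DecidableEq ι] {m : ℕ} (pos : B → Fin m → ι)
    (δ : ℝ) (J : B → Fin m) : ι → ℝ :=
  ∑ b, Pi.single (pos b (J b)) δ

section Spikes

variable {ι B : Type*} [Fintype B] [DecidableEq ι] {m : ℕ} {pos : B → Fin m → ι}

lemma spikes_apply_pos (hpos : Function.Injective (fun x : B × Fin m => pos x.1 x.2))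
    (δ : ℝ) (J : B → Fin m) (b : B) (j : Fin m) :
    spikes pos δ J (pos b j) = if j = J b then δ else 0 := by
  rw [spikes, Finset.sum_apply, Finset.sum_eq_single b]
  · have : pos b j = pos b (J b) ↔ j = J b :=
      ⟨fun h => (Prod.ext_iff.mp (@hpos (b, j) (b, J b) h)).2, fun h => by rw [h]⟩
    simp [Pi.single_apply, this]
  · intro b' _ hb'
    refine Pi.single_eq_of_ne (fun h => hb' ?_) _
    exact (Prod.ext_iff.mp (@hpos (b, j) (b', J b') h)).1.symm
  · simp

/-- Spikes of distinct blocks never overlap, so the `l_q` sum of a row becomes a plain sum of spikes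
of size `δ ^ q`. -/
lemma abs_spikes_rpow (hpos : Function.Injective (fun x : B × Fin m => pos x.1 x.2))
    {δ q : ℝ} (hδ : 0 ≤ δ) (hq : 0 < q) (J : B → Fin m) (i : ι) :
    |spikes pos δ J i| ^ q = spikes pos (δ ^ q) J i := by
  by_cases h : ∃ b j, pos b j = i
  · obtain ⟨b, j, rfl⟩ := h
    rw [spikes_apply_pos hpos, spikes_apply_pos hpos]
    split_ifs
    · rw [abs_of_nonneg hδ]
    · rw [abs_zero, Real.zero_rpow hq.ne']
  · push Not at h
    have h0 : ∀ x, spikes pos x J i = 0 := fun x => by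
      rw [spikes, Finset.sum_apply]
      exact Finset.sum_eq_zero fun b _ => Pi.single_eq_of_ne (h b _).symm _
    rw [h0, h0, abs_zero, Real.zero_rpow hq.ne']

/-- Cyclic addition in `Fin m` moves the spike of block `b` through all positions while the other
spikes stay fixed. -/
lemma spikes_add_single [DecidableEq B] [NeZero m] (δ : ℝ) (J : B → Fin m) (b : B) (j : Fin m) :
    spikes pos δ (J + Pi.single b j) =
      (∑ b' ∈ Finset.univ.erase b, Pi.single (pos b' (J b')) δ) +
        Pi.single (pos b (J b + j)) δ := by
  rw [spikes, ← Finset.sum_erase_add _ _ (Finset.mem_univ b)]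
  congr 1
  · refine Finset.sum_congr rfl fun b' hb' => ?_
    simp [Pi.single_eq_of_ne (Finset.ne_of_mem_erase hb')]
  · simp

/-- Two spikes of size `δ` at different positions cannot both be within squared distance
`δ² / 2` of the same vector. -/
lemma not_both_close {m : ℕ} (z : Fin m → ℝ) (δ : ℝ) {u u' : Fin m} (hu : u ≠ u')
    (h : ∑ i, (z i - if i = u then δ else 0) ^ 2 < δ ^ 2 / 2)
    (h' : ∑ i, (z i - if i = u' then δ else 0) ^ 2 < δ ^ 2 / 2) : False := by
  have key : ∀ w : Fin m, (z u - if u = w then δ else 0) ^ 2 + (z u' - if u' = w then δ else 0) ^ 2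
      ≤ ∑ i, (z i - if i = w then δ else 0) ^ 2 := fun w => by
    rw [← Finset.sum_pair (f := fun i => (z i - if i = w then δ else 0) ^ 2) hu]
    exact Finset.sum_le_sum_of_subset_of_nonneg (Finset.subset_univ _)
      fun _ _ _ => sq_nonneg _
  have k1 := key u
  have k2 := key u'
  simp only [if_true, hu, hu.symm, if_false, sub_zero] at k1 k2
  -- At each of the two positions, `z ^ 2 + (z - δ) ^ 2 ≥ δ ^ 2 / 2`.
  nlinarith [sq_nonneg (2 * z u - δ), sq_nonneg (2 * z u' - δ)]

/-- The squared error of `T` on the block `b`, when `spikes pos δ J + y` is observed. -/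
noncomputable def blockLoss (pos : B → Fin m → ι) (δ : ℝ) (T : (ι → ℝ) → ι → ℝ)
    (J : B → Fin m) (b : B) (y : ι → ℝ) : ℝ :=
  ∑ j, (T (spikes pos δ J + y) (pos b j) - spikes pos δ J (pos b j)) ^ 2

lemma measurable_blockLoss [Fintype ι] (δ : ℝ) {T : (ι → ℝ) → ι → ℝ} (hT : Measurable T)
    (J : B → Fin m) (b : B) : Measurable (blockLoss pos δ T J b) := by
  unfold blockLoss
  have : ∀ i, Measurable fun y => T (spikes pos δ J + y) i := fun i =>
    (measurable_pi_apply i).comp (hT.comp (by fun_prop))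
  fun_prop

lemma sum_blockLoss_le [Fintype ι] (hpos : Function.Injective (fun x : B × Fin m => pos x.1 x.2))
    (δ : ℝ) (T : (ι → ℝ) → ι → ℝ) (J : B → Fin m) (y : ι → ℝ) :
    ∑ b, blockLoss pos δ T J b y ≤
      ∑ i, (T (spikes pos δ J + y) i - spikes pos δ J i) ^ 2 := by
  unfold blockLoss
  rw [← Fintype.sum_prod_type' (f := fun b j =>
    (T (spikes pos δ J + y) (pos b j) - spikes pos δ J (pos b j)) ^ 2)]
  refine (Finset.sum_map Finset.univ ⟨_, hpos⟩
    (fun i => (T (spikes pos δ J + y) i - spikes pos δ J i) ^ 2)).symm.trans_le ?_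
  exact Finset.sum_le_sum_of_subset_of_nonneg (Finset.subset_univ _) fun _ _ _ => sq_nonneg _

variable [Fintype ι] [DecidableEq B] {v : NNReal}

/-- Freezing the other spikes makes "small loss on block `b`" an acceptance region for the position
of its spike. By `not_both_close` these regions are disjoint, so the testing bound applies. -/
lemma sum_measure_blockLoss_lt_le [NeZero m] (hv : v ≠ 0)
    (hpos : Function.Injective (fun x : B × Fin m => pos x.1 x.2)) {δ : ℝ}
    (hδ : Real.exp (δ ^ 2 / v) ≤ 5 / 7 * m) {T : (ι → ℝ) → ι → ℝ} (hT : Measurable T)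
    (J : B → Fin m) (b : B) :
    ∑ j, (Measure.pi fun _ : ι => gaussianReal 0 v).real
      {y | blockLoss pos δ T (J + Pi.single b j) b y < δ ^ 2 / 2} ≤ 7 / 8 * m := by
  set a : ι → ℝ := ∑ b' ∈ Finset.univ.erase b, Pi.single (pos b' (J b')) δ with ha
  let S : Fin m → Set (ι → ℝ) := fun j =>
    {y | ∑ i, (T (a + y) (pos b i) - if i = J b + j then δ else 0) ^ 2 < δ ^ 2 / 2}
  have hS : ∀ j, MeasurableSet (S j) := fun j => by
    have : ∀ i, Measurable fun y => T (a + y) i := fun i =>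
      (measurable_pi_apply i).comp (hT.comp (by fun_prop))
    exact measurableSet_lt (by fun_prop) measurable_const
  have hd : Pairwise (Function.onFun Disjoint S) := by
    intro j j' hj
    rw [Function.onFun, Set.disjoint_left]
    intro y hy hy'
    exact not_both_close (fun i => T (a + y) (pos b i)) δ
      (fun h => hj (add_left_cancel h)) hy hy'
  have hset : ∀ j, {y | blockLoss pos δ T (J + Pi.single b j) b y < δ ^ 2 / 2} =
      {y | y + Pi.single (pos b (J b + j)) δ ∈ S j} := by
    intro j
    ext y
    simp only [Set.mem_ofPred_eq, S, blockLoss, spikes_apply_pos hpos]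
    rw [spikes_add_single, ← ha, add_assoc, add_comm (Pi.single _ _) y]
    simp
  have h := sum_pi_gaussianReal_add_single_le hv (NeZero.pos m) (fun j => pos b (J b + j)) δ hδ
    S hS hd
  simp_rw [hset, measureReal_def]
  rw [← ENNReal.toReal_sum fun j _ => measure_ne_top _ _]
  exact ENNReal.toReal_le_of_le_ofReal (by positivity) h

/-- Averaging over all shifts of one coordinate. -/
lemma sum_le_of_sum_add_single_le [NeZero m] (f : (B → Fin m) → ℝ) (b : B) (C : ℝ)
    (h : ∀ J : B → Fin m, ∑ j : Fin m, f (J + Pi.single b j) ≤ C * m) :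
    ∑ J, f J ≤ C * Fintype.card (B → Fin m) := by
  have h1 : (m : ℝ) * ∑ J, f J = ∑ J : B → Fin m, ∑ j : Fin m, f (J + Pi.single b j) := by
    rw [Finset.sum_comm]
    have : ∀ j : Fin m, ∑ J : B → Fin m, f (J + Pi.single b j) = ∑ J, f J := fun j =>
      Fintype.sum_equiv (Equiv.addRight (Pi.single b j)) _ _ fun _ => rfl
    simp [this]
  have h2 : ∑ J : B → Fin m, ∑ j : Fin m, f (J + Pi.single b j) ≤ ∑ _J : B → Fin m, C * m :=
    Finset.sum_le_sum fun J _ => h J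
  rw [← h1, Finset.sum_const, Finset.card_univ, nsmul_eq_mul] at h2
  have hm : (0 : ℝ) < m := by exact_mod_cast NeZero.pos m
  refine le_of_mul_le_mul_left (h2.trans_eq ?_) hm
  ring

/-- The bound holds for every block on average over all placements, so some placement satisfies it
for the sum over blocks. -/
lemma exists_sum_blockLoss_lt_le [NeZero m] (hv : v ≠ 0)
    (hpos : Function.Injective (fun x : B × Fin m => pos x.1 x.2)) {δ : ℝ}
    (hδ : Real.exp (δ ^ 2 / v) ≤ 5 / 7 * m) {T : (ι → ℝ) → ι → ℝ} (hT : Measurable T) :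
    ∃ J : B → Fin m, ∑ b, (Measure.pi fun _ : ι => gaussianReal 0 v).real
      {y | blockLoss pos δ T J b y < δ ^ 2 / 2} ≤ 7 / 8 * Fintype.card B := by
  obtain ⟨J, -, hJ⟩ := Finset.exists_le_of_sum_le (s := (Finset.univ : Finset (B → Fin m)))
    (f := fun J => ∑ b, (Measure.pi fun _ : ι => gaussianReal 0 v).real
      {y | blockLoss pos δ T J b y < δ ^ 2 / 2})
    (g := fun _ => 7 / 8 * (Fintype.card B : ℝ)) Finset.univ_nonempty (by
      rw [Finset.sum_comm]
      calc _ ≤ ∑ _b : B, 7 / 8 * (Fintype.card (B → Fin m) : ℝ) :=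
            Finset.sum_le_sum fun b _ => sum_le_of_sum_add_single_le _ b _ fun J =>
              sum_measure_blockLoss_lt_le hv hpos hδ hT J b
        _ = _ := by
          rw [Finset.sum_const, Finset.sum_const, Finset.card_univ, Finset.card_univ, nsmul_eq_mul,
            nsmul_eq_mul]
          ring)
  exact ⟨J, hJ⟩

/-- Lower bound in probability for the estimation of a vector made of one spike per block. -/
lemma exists_spikes_lower_bound [NeZero m] [Nonempty B] (hv : v ≠ 0)
    (hpos : Function.Injective (fun x : B × Fin m => pos x.1 x.2)) {δ : ℝ}
    (hδ : Real.exp (δ ^ 2 / v) ≤ 5 / 7 * m) {T : (ι → ℝ) → ι → ℝ} (hT : Measurable T) :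
    ∃ J : B → Fin m, 1 / 16 ≤ (Measure.pi fun _ : ι => gaussianReal 0 v).real
      {y | Fintype.card B * δ ^ 2 / 32 ≤
        ∑ i, (T (spikes pos δ J + y) i - spikes pos δ J i) ^ 2} := by
  obtain ⟨J, hJ⟩ := exists_sum_blockLoss_lt_le (v := v) hv hpos hδ hT
  refine ⟨J, ?_⟩
  set μ := Measure.pi fun _ : ι => gaussianReal 0 v
  set N : ℝ := (Fintype.card B : ℝ)
  have hN : 0 < N := by simp only [N]; exact_mod_cast Fintype.card_pos
  let G : B → Set (ι → ℝ) := fun b => {y | blockLoss pos δ T J b y < δ ^ 2 / 2}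
  have hG : ∀ b, MeasurableSet (G b) := fun b =>
    measurableSet_lt (measurable_blockLoss δ hT J b) measurable_const
  let E : Set (ι → ℝ) := {y | N * δ ^ 2 / 32 ≤
    ∑ i, (T (spikes pos δ J + y) i - spikes pos δ J i) ^ 2}
  have hE : MeasurableSet E := by
    have : ∀ i, Measurable fun y => T (spikes pos δ J + y) i := fun i =>
      (measurable_pi_apply i).comp (hT.comp (by fun_prop))
    exact measurableSet_le measurable_const (by fun_prop)
  -- `F` counts the blocks with small loss.
  let F : (ι → ℝ) → ℝ := fun y => ∑ b, (G b).indicator 1 y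
  have hint : ∀ b, Integrable ((G b).indicator (1 : (ι → ℝ) → ℝ)) μ := fun b =>
    (integrable_const (1 : ℝ)).indicator (hG b)
  have hF : ∫ y, F y ∂μ = ∑ b, μ.real (G b) := by
    rw [integral_finsetSum _ fun b _ => hint b]
    exact Finset.sum_congr rfl fun b _ => integral_indicator_one (hG b)
  have hmarkov := mul_meas_ge_le_integral_of_nonneg (μ := μ) (f := F)
    (.of_forall fun y => Finset.sum_nonneg fun b _ =>
      Set.indicator_nonneg (fun _ _ => zero_le_one) _)
    (integrable_finsetSum _ fun b _ => hint b) (15 / 16 * N)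
  rw [hF] at hmarkov
  -- Each remaining block costs at least `δ ^ 2 / 2`, so a total below `N * δ ^ 2 / 32` leaves fewer
  -- than `N / 16` of them.
  have hsub : Eᶜ ⊆ {y | 15 / 16 * N ≤ F y} := by
    intro y hy
    simp only [E, Set.mem_compl_iff, Set.mem_ofPred_eq, not_le] at hy
    have hL := (sum_blockLoss_le hpos δ T J y).trans_lt hy
    have hb : ∀ b, δ ^ 2 / 2 * (1 - (G b).indicator (1 : (ι → ℝ) → ℝ) y) ≤
        blockLoss pos δ T J b y := by
      intro b
      by_cases h : y ∈ G b
      · rw [Set.indicator_of_mem h]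
        simp only [Pi.one_apply, sub_self, mul_zero]
        exact Finset.sum_nonneg fun _ _ => sq_nonneg _
      · rw [Set.indicator_of_notMem h, sub_zero, mul_one]
        simpa [G] using h
    have hs := (Finset.sum_le_sum fun b (_ : b ∈ Finset.univ) => hb b).trans_lt hL
    rw [← Finset.mul_sum, Finset.sum_sub_distrib] at hs
    simp only [Finset.sum_const, Finset.card_univ, nsmul_eq_mul, mul_one] at hs
    change δ ^ 2 / 2 * (N - F y) < _ at hs
    simp only [Set.mem_ofPred_eq]
    by_contra hcon
    push Not at hcon
    nlinarith [sq_nonneg δ]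
  have h1 : μ.real Eᶜ ≤ μ.real {y | 15 / 16 * N ≤ F y} := measureReal_mono hsub
  have h2 : 15 / 16 * N * μ.real Eᶜ ≤ 7 / 8 * N :=
    (mul_le_mul_of_nonneg_left h1 (by positivity)).trans (hmarkov.trans hJ)
  -- The ratio of 7/8 to 15/16.
  have h3 : μ.real Eᶜ ≤ 14 / 15 := by
    by_contra hcon
    push Not at hcon
    nlinarith
  rw [probReal_compl_eq_one_sub hE] at h3
  change 1 / 16 ≤ μ.real E
  linarith

end Spikes

/-! ### Matrices, rescaling to unit noise, and the two bounds. -/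

lemma sq_frobNorm {n₁ n₂ : ℕ} (A : Matrix (Fin n₁) (Fin n₂) ℝ) :
    frobNorm A ^ 2 = ∑ p : Fin n₁ × Fin n₂, A p.1 p.2 ^ 2 := by
  rw [frobNorm, Real.sq_sqrt (by positivity), Fintype.sum_prod_type]

/-- Positions in an `n₁ × n₂` matrix of the entries of the `k` blocks of length `m` of each row. -/
def blockPos {n₁ n₂ k m : ℕ} (h : k * m ≤ n₂) (b : Fin n₁ × Fin k) (j : Fin m) :
    Fin n₁ × Fin n₂ :=
  (b.1, Fin.castLE h (finProdFinEquiv (b.2, j)))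

lemma blockPos_injective {n₁ n₂ k m : ℕ} (h : k * m ≤ n₂) :
    Function.Injective (fun x : (Fin n₁ × Fin k) × Fin m => blockPos h x.1 x.2) := by
  rintro ⟨⟨i, b⟩, j⟩ ⟨⟨i', b'⟩, j'⟩ hx
  simp only [blockPos, Prod.mk.injEq] at hx
  have := finProdFinEquiv.injective (Fin.castLE_injective h hx.2)
  simp_all

lemma sum_spikes_blockPos {n₁ n₂ k m : ℕ} (h : k * m ≤ n₂) (x : ℝ)
    (J : Fin n₁ × Fin k → Fin m) (i : Fin n₁) :
    ∑ j, spikes (blockPos h) x J (i, j) = k * x := by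
  have h1 : ∀ b : Fin n₁ × Fin k, ∑ j, (Pi.single (blockPos h b (J b)) x :
      Fin n₁ × Fin n₂ → ℝ) (i, j) = if b.1 = i then x else 0 := by
    intro b
    simp only [Pi.single_apply, blockPos, Prod.mk.injEq]
    by_cases hb : b.1 = i
    · simp [hb]
    · simp [hb, Ne.symm hb]
  simp only [spikes, Finset.sum_apply]
  rw [Finset.sum_comm]
  simp_rw [h1]
  rw [Fintype.sum_prod_type' (f := fun (i' : Fin n₁) (_ : Fin k) => if i' = i then x else 0),
    Finset.sum_comm]
  simp

/-- Scaling by `σ` reduces to unit noise with budget `s / σ ^ q`. -/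
lemma etaRate_eq (n₁ n₂ : ℕ) {q s σ : ℝ} (hq : 0 < q) (hs : 0 < s) (hσ : 0 < σ) :
    etaRate n₁ n₂ q s σ = n₁ * σ ^ 2 * min (min (s / σ ^ q *
      Real.log (1 + n₂ / (s / σ ^ q)) ^ (1 - q / 2)) ((s / σ ^ q) ^ (2 / q))) n₂ := by
  have hσq : 0 < σ ^ q := Real.rpow_pos_of_pos hσ q
  have hlog : 0 ≤ Real.log (1 + n₂ / (s / σ ^ q)) :=
    Real.log_nonneg (by linarith [show 0 ≤ (n₂ : ℝ) / (s / σ ^ q) by positivity])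
  have e0 : σ ^ q * n₂ / s = n₂ / (s / σ ^ q) := by field_simp
  have e1 : (σ ^ 2) ^ (1 - q / 2) = σ ^ 2 / σ ^ q := by
    rw [← Real.rpow_natCast, ← Real.rpow_mul hσ.le, ← Real.rpow_sub hσ]
    congr 1; push_cast; ring
  have e2 : (s / σ ^ q) ^ (2 / q) = s ^ (2 / q) / σ ^ 2 := by
    rw [Real.div_rpow hs.le hσq.le, ← Real.rpow_mul hσ.le, mul_div_cancel₀ _ hq.ne',
      ← Real.rpow_natCast]
    norm_num
  rw [etaRate, e0, Real.mul_rpow (by positivity) hlog, e1, e2,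
    mul_min_of_nonneg _ _ (by positivity), mul_min_of_nonneg _ _ (by positivity)]
  congr 1
  · congr 1 <;> field_simp
  · ring

lemma IsGaussianNoise.hasLaw_pi {Ω : Type*} [MeasurableSpace Ω] {n₁ n₂ : ℕ} {P : Measure Ω}
    {ξ : Ω → Matrix (Fin n₁) (Fin n₂) ℝ} {σ : ℝ} (h : IsGaussianNoise P ξ σ) :
    HasLaw (fun ω (p : Fin n₁ × Fin n₂) => ξ ω p.1 p.2)
      (Measure.pi fun _ => gaussianReal 0 (σ ^ 2).toNNReal) P := by
  refine ⟨aemeasurable_pi_lambda _ fun p => (h.2 p.1 p.2).aemeasurable, ?_⟩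
  refine (h.1.map_fun_eq_pi_map fun p : Fin n₁ × Fin n₂ => (h.2 p.1 p.2).aemeasurable).trans ?_
  congr 1
  ext1 p
  exact (h.2 p.1 p.2).map_eq

/-- The square of the left side is at most `m`, and `m ≤ 25 / 49 * m ^ 2` as soon as `m ≥ 2`; this
is where 5/7, just above `1 / √2`, comes from. -/
lemma exp_le_of_sq_le_log {m : ℕ} (hm : 2 ≤ m) {d : ℝ} (hd : d ^ 2 ≤ Real.log m / 2) :
    Real.exp (d ^ 2) ≤ 5 / 7 * m := by
  have hm' : (2 : ℝ) ≤ m := by exact_mod_cast hm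
  refine abs_le_of_sq_le_sq' ?_ (by positivity) |>.2
  rw [← Real.exp_nat_mul]
  calc _ ≤ Real.exp (Real.log m) := Real.exp_le_exp.mpr (by push_cast; linarith)
    _ = m := Real.exp_log (by linarith)
    _ ≤ _ := by nlinarith

lemma ofReal_mul_le_lintegral_of_le_measure {Ω : Type*} [MeasurableSpace Ω] {P : Measure Ω}
    {f : Ω → ℝ} (hf : AEMeasurable f P) {x b : ℝ} (hx : 0 ≤ x)
    (h : ENNReal.ofReal b ≤ P {ω | x ≤ f ω}) :
    ENNReal.ofReal (x * b) ≤ ∫⁻ ω, ENNReal.ofReal (f ω) ∂P := by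
  rw [ENNReal.ofReal_mul hx]
  refine le_trans ?_ (mul_meas_ge_le_lintegral₀ hf.ennreal_ofReal (ENNReal.ofReal x))
  gcongr
  exact h.trans (measure_mono fun ω hω => ENNReal.ofReal_le_ofReal hω)

lemma aemeasurable_sq_frobNorm {Ω : Type*} [MeasurableSpace Ω] {n₁ n₂ : ℕ} {P : Measure Ω}
    {ξ : Ω → Matrix (Fin n₁) (Fin n₂) ℝ} {σ : ℝ} (hξ : IsGaussianNoise P ξ σ)
    {T : Matrix (Fin n₁) (Fin n₂) ℝ → Matrix (Fin n₁) (Fin n₂) ℝ} (hT : IsEstimator T)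
    (A : Matrix (Fin n₁) (Fin n₂) ℝ) :
    AEMeasurable (fun ω => frobNorm (T (A + ξ ω) - A) ^ 2) P := by
  have hY : AEMeasurable (fun ω i j => A i j + ξ ω i j) P :=
    aemeasurable_pi_lambda _ fun i => aemeasurable_pi_lambda _ fun j =>
      (hξ.2 i j).aemeasurable.const_add _
  have e : ∀ ω, A + ξ ω = Matrix.of fun i j => A i j + ξ ω i j := fun _ => rfl
  have hij : ∀ i j, AEMeasurable (fun ω => T (A + ξ ω) i j) P := fun i j => by
    simp_rw [e]
    exact (((measurable_pi_apply j).comp (measurable_pi_apply i)).comp hT).comp_aemeasurable hY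
  simp_rw [sq_frobNorm, Matrix.sub_apply]
  exact Finset.aemeasurable_fun_sum _ fun p _ => ((hij p.1 p.2).sub_const _).pow_const 2

/-- For every estimator some matrix of the class `A(q, s)` is estimated with a squared error of
order `η(s)`, with probability bounded below. -/
lemma exists_softSparse_lower_bound {n₁ n₂ : ℕ} (hn₁ : 2 ≤ n₁) (hn₂ : 2 ≤ n₂) {q s σ : ℝ}
    (hq : 0 < q) (hs : 0 < s) (hσ : 0 < σ) {Ω : Type*} [MeasurableSpace Ω]
    (P : Measure Ω) {ξ : Ω → Matrix (Fin n₁) (Fin n₂) ℝ} (hξ : IsGaussianNoise P ξ σ)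
    {T : Matrix (Fin n₁) (Fin n₂) ℝ → Matrix (Fin n₁) (Fin n₂) ℝ} (hT : IsEstimator T) :
    ∃ A ∈ softSparse n₁ n₂ q s, ENNReal.ofReal (1 / 16) ≤
      P {ω | 1 / 384 * etaRate n₁ n₂ q s σ ≤ frobNorm (T (A + ξ ω) - A) ^ 2} := by
  have hσq : 0 < σ ^ q := Real.rpow_pos_of_pos hσ q
  obtain ⟨k, m, d, hk, hm, hkm, hd, hdm, hkd, hrate⟩ :=
    exists_spike_parameters n₂ hn₂ q (s / σ ^ q) hq (by positivity)
  have : NeZero m := ⟨by omega⟩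
  have : NeZero k := ⟨by omega⟩
  have : NeZero n₁ := ⟨by omega⟩
  have hv : (σ ^ 2).toNNReal ≠ 0 := by
    rw [Ne, Real.toNNReal_eq_zero, not_le]; positivity
  have hexp : Real.exp ((σ * d) ^ 2 / (σ ^ 2).toNNReal) ≤ 5 / 7 * m := by
    rw [Real.coe_toNNReal _ (by positivity), mul_pow, mul_div_cancel_left₀ _ (by positivity)]
    exact exp_le_of_sq_le_log hm hdm
  let T' : (Fin n₁ × Fin n₂ → ℝ) → Fin n₁ × Fin n₂ → ℝ := fun y p =>
    T (Matrix.of fun i j => y (i, j)) p.1 p.2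
  have hT' : Measurable T' := by
    have h1 : Measurable fun (y : Fin n₁ × Fin n₂ → ℝ) i j => T (Matrix.of fun i j => y (i, j)) i j :=
      hT.comp (f := fun (y : Fin n₁ × Fin n₂ → ℝ) i j => y (i, j)) (by fun_prop)
    exact measurable_pi_lambda _ fun p =>
      (measurable_pi_apply p.2).comp ((measurable_pi_apply p.1).comp h1)
  obtain ⟨J, hJ⟩ := exists_spikes_lower_bound hv (blockPos_injective (n₁ := n₁) hkm) hexp hT'
  set a := spikes (blockPos hkm) (σ * d) J with ha
  refine ⟨Matrix.of fun i j => a (i, j), fun i => ?_, ?_⟩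
  · change ∑ j, |a (i, j)| ^ q ≤ s
    simp_rw [ha, abs_spikes_rpow (blockPos_injective hkm) (mul_pos hσ hd).le hq]
    rw [sum_spikes_blockPos, Real.mul_rpow hσ.le hd.le]
    rw [le_div_iff₀ hσq] at hkd
    linarith
  · have hmeas : MeasurableSet {y : Fin n₁ × Fin n₂ → ℝ |
        Fintype.card (Fin n₁ × Fin k) * (σ * d) ^ 2 / 32 ≤ ∑ i, (T' (a + y) i - a i) ^ 2} := by
      have : ∀ i, Measurable fun y => T' (a + y) i := fun i =>
        (measurable_pi_apply i).comp (hT'.comp (by fun_prop))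
      exact measurableSet_le measurable_const (by fun_prop)
    rw [measureReal_def, ← hξ.hasLaw_pi.measure_eq hmeas] at hJ
    refine (ENNReal.ofReal_le_of_le_toReal hJ).trans (measure_mono fun ω hω => ?_)
    simp only [Set.mem_ofPred_eq] at hω ⊢
    rw [sq_frobNorm]
    refine le_trans ?_ hω
    rw [etaRate_eq n₁ n₂ hq hs hσ, Fintype.card_prod, Fintype.card_fin, Fintype.card_fin]
    push_cast
    -- 384 is 32 from the Markov step times 12 from the choice of parameters.
    calc _ ≤ 1 / 384 * (n₁ * σ ^ 2 * (12 * (k * d ^ 2))) := by gcongr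
      _ = _ := by ring

lemma etaRate_nonneg (n₁ n₂ : ℕ) {q s σ : ℝ} (hs : 0 < s) (hσ : 0 < σ) :
    0 ≤ etaRate n₁ n₂ q s σ := by
  have hσq : 0 < σ ^ q := Real.rpow_pos_of_pos hσ q
  have : 0 ≤ Real.log (1 + σ ^ q * n₂ / s) :=
    Real.log_nonneg (by linarith [show 0 ≤ σ ^ q * (n₂ : ℝ) / s by positivity])
  unfold etaRate
  positivity

theorem theorem2 :
    ∃ c β : ℝ, 0 < c ∧ 0 < β ∧ β < 1 ∧
      ∀ (n₁ n₂ : ℕ), 2 ≤ n₁ → 2 ≤ n₂ →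
      ∀ (q s σ : ℝ), 0 < q → q < 2 → 0 < s → 0 < σ →
      ∀ (Ω : Type*) [MeasurableSpace Ω] (P : Measure Ω) [IsProbabilityMeasure P]
        (ξ : Ω → Matrix (Fin n₁) (Fin n₂) ℝ), IsGaussianNoise P ξ σ →
        (ENNReal.ofReal β ≤
          ⨅ (T : Matrix (Fin n₁) (Fin n₂) ℝ → Matrix (Fin n₁) (Fin n₂) ℝ) (_ : IsEstimator T),
            ⨆ A ∈ softSparse n₁ n₂ q s,
              P {ω | c * etaRate n₁ n₂ q s σ ≤ frobNorm (T (A + ξ ω) - A) ^ 2}) ∧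
        (ENNReal.ofReal (c * etaRate n₁ n₂ q s σ) ≤
          ⨅ (T : Matrix (Fin n₁) (Fin n₂) ℝ → Matrix (Fin n₁) (Fin n₂) ℝ) (_ : IsEstimator T),
            ⨆ A ∈ softSparse n₁ n₂ q s,
              ∫⁻ ω, ENNReal.ofReal (frobNorm (T (A + ξ ω) - A) ^ 2) ∂P) := by
  -- One constant serves both bounds: 6144 = 384 * 16, the factor 16 being the probability lost when
  -- passing to the expectation.
  refine ⟨1 / 6144, 1 / 16, by norm_num, by norm_num, by norm_num, ?_⟩
  intro n₁ n₂ hn₁ hn₂ q s σ hq _ hs hσ Ω _ P _ ξ hξ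
  have hη := etaRate_nonneg n₁ n₂ (q := q) hs hσ
  refine ⟨le_iInf₂ fun T hT => ?_, le_iInf₂ fun T hT => ?_⟩ <;>
    obtain ⟨A, hA, hP⟩ := exists_softSparse_lower_bound hn₁ hn₂ hq hs hσ P hξ hT <;>
    refine le_trans ?_ (le_iSup₂_of_le A hA le_rfl)
  · have hc : 1 / 6144 * etaRate n₁ n₂ q s σ ≤ 1 / 384 * etaRate n₁ n₂ q s σ := by linarith
    exact hP.trans (measure_mono fun ω hω => hc.trans hω)
  · refine le_of_eq_of_le ?_ (ofReal_mul_le_lintegral_of_le_measure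
      (aemeasurable_sq_frobNorm hξ hT A) (by positivity) hP)
    congr 1
    ring
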